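/- All graphs are finite, simple and undirected. A graph is $1$-degenerate (equivalently, a forest) if each of its subgraphs with at least one vertex has a vertex of degree at most $1$. A matching $M$ in a graph $G$ is acyclic (or $1$-degenerate) if the subgraph of $G$ induced by the set of vertices incident with an edge of $M$ is $1$-degenerate. The acyclic chromatic index $\chi'_1(G)$ is the minimum number of acyclic matchings of $G$ into which the edge set of $G$ can be partitioned. Theorem 2. Let $\Delta\geq 1$ be an integer, and let $G$ be a connected graph of maximum degree at most $\Delta$. Then $\chi'_1(G)=\Delta^2$ if and only if $G$ is isomorphic to the complete bipartite graph $K_{\Delta,\Delta}$. -/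

import Mathlib

/-- A graph is `r`-degenerate if every subgraph of order at least one has a vertex of degree
at most `r` (the degree being taken in that subgraph). -/
def IsDegenerate {V : Type*} (r : ℕ) (G : SimpleGraph V) : Prop :=
  ∀ H : G.Subgraph, H.verts.Nonempty → ∃ v ∈ H.verts, (H.neighborSet v).encard ≤ (r : ℕ∞)

/-- A set `M` of edges of `G` is a matching if no two distinct edges in `M` share a vertex. -/
def IsEdgeMatching {V : Type*} (G : SimpleGraph V) (M : Set (Sym2 V)) : Prop :=
  M ⊆ G.edgeSet ∧ ∀ e ∈ M, ∀ f ∈ M, e ≠ f → ∀ v : V, ¬ (v ∈ e ∧ v ∈ f)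

/-- The set `V(M)` of vertices incident with an edge in `M`. -/
def coveredVertices {V : Type*} (M : Set (Sym2 V)) : Set V :=
  {v | ∃ e ∈ M, v ∈ e}

/-- A matching `M` of `G` is `r`-degenerate if the induced subgraph `G[V(M)]` is
`r`-degenerate. -/
def IsDegenerateMatching {V : Type*} (r : ℕ) (G : SimpleGraph V) (M : Set (Sym2 V)) : Prop :=
  IsEdgeMatching G M ∧ IsDegenerate r (G.induce (coveredVertices M))

/-- The set of edges of `G` that receive the color `a` from `c`. -/
def colorClass {V K : Type*} (G : SimpleGraph V) (c : G.edgeSet → K) (a : K) : Set (Sym2 V) :=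
  {e | ∃ h : e ∈ G.edgeSet, c ⟨e, h⟩ = a}

/-- An edge coloring of `G` is `r`-degenerate if each of its color classes is an `r`-degenerate
matching of `G`. -/
def IsDegenerateEdgeColoring {V K : Type*} (r : ℕ) (G : SimpleGraph V) (c : G.edgeSet → K) :
    Prop :=
  ∀ a : K, IsDegenerateMatching r G (colorClass G c a)

/-- The `r`-degenerate chromatic index `χ'_r(G)`: the minimum number of colors in an
`r`-degenerate edge coloring of `G` (and `⊤` if there is no such coloring). -/
noncomputable def degenerateChromaticIndex {V : Type*} (r : ℕ) (G : SimpleGraph V) : ℕ∞ :=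
  ⨅ k ∈ {k : ℕ | ∃ c : G.edgeSet → Fin k, IsDegenerateEdgeColoring r G c}, (k : ℕ∞)

/-!
Two disjoint edges of `K_{Δ,Δ}` span a 4-cycle, so every 1-degenerate edge colouring of
`K_{Δ,Δ}` is injective and the index is the number `Δ ^ 2` of edges
(`injective_of_isDegenerateEdgeColoring`, `card_edgeSet_of_iso_completeBipartiteGraph`).

For the converse, take a partial colouring of `G` by acyclic matchings with `Δ ^ 2 - 1` colours and
as many coloured edges as possible. If it colours all edges, the index is less than `Δ ^ 2`.
Otherwise some edge `uv`, a hole, is uncoloured and no colour can be given to it. A colour is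
unavailable only if it occurs on an edge adjacent to `uv`, or if it covers two of the at most
`2 * (Δ - 1)` neighbours of `u` and `v` outside the edge (counted once for `u` and once for `v`).
Double counting shows that the number of colours is just small enough for this to happen, with
equality in every estimate (`IsMaximumColoring.isTightHole`): `u` and `v` have degree `Δ`, have no
common neighbour, all edges adjacent to `uv` are coloured, and their colours occur nowhere else
nearby.

Hence the hole can be moved to an adjacent edge `uw`, by giving the colour `p` of `uw` to `uv`
(`IsMaximumColoring.shift`). Moving it twice, along `uv`, `uw`, `wx`, and asking why `p` is
unavailable for `wx` shows that `x` is adjacent to `v` (`IsMaximumColoring.adj_of_adj_adj`). So all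
neighbours of `u` have the same neighbours as `v`, symmetrically all neighbours of `v` have the
same neighbours as `u`, and by connectedness `G` is `K_{Δ,Δ}` (`IsMaximumColoring.nonempty_iso`).
-/

/-! ### Vertex sets spanning forests -/

/-- A set `S` of vertices spans a forest of `G`: every nonempty subset contains a vertex with at
most one neighbour in that subset. -/
def SpansForest {V : Type*} (G : SimpleGraph V) (S : Set V) : Prop :=
  ∀ T ⊆ S, T.Nonempty → ∃ v ∈ T, ∀ x ∈ T, ∀ y ∈ T, G.Adj v x → G.Adj v y → x = y

namespace SpansForest

variable {V : Type*} {G : SimpleGraph V} {S T : Set V}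

lemma mono (h : SpansForest G S) (hTS : T ⊆ S) : SpansForest G T :=
  fun R hR => h R (hR.trans hTS)

lemma insert (h : SpansForest G S) {v : V}
    (hv : ∀ x ∈ S, ∀ y ∈ S, G.Adj v x → G.Adj v y → x = y) :
    SpansForest G (insert v S) := by
  intro T hT hne
  by_cases hvT : v ∈ T
  · refine ⟨v, hvT, fun x hx y hy hvx hvy => ?_⟩
    exact hv x ((hT hx).resolve_left hvx.ne') y ((hT hy).resolve_left hvy.ne') hvx hvy
  · exact h T (fun x hx => (hT hx).resolve_left (by rintro rfl; exact hvT hx)) hne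

/-- Adding two adjacent vertices joined to a forest by at most one edge yields a forest. -/
lemma insert_pair (h : SpansForest G S) {u v : V}
    (huv : ∀ s x t y, (s = u ∨ s = v) → (t = u ∨ t = v) → x ∈ S → y ∈ S →
      G.Adj s x → G.Adj t y → s = t ∧ x = y) :
    SpansForest G (Insert.insert u (Insert.insert v S)) := by
  by_cases hu : ∃ x ∈ S, G.Adj u x
  · obtain ⟨x, hx, hux⟩ := hu
    by_cases huv' : u = v
    · subst huv'
      rw [Set.insert_eq_of_mem (Set.mem_insert _ _)]
      exact h.insert fun y hy z hz h1 h2 =>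
        (huv u y u z (.inl rfl) (.inl rfl) hy hz h1 h2).2
    -- `v` sends no edge to `S`, so it is inserted last.
    have hv : ∀ y ∈ S, ¬ G.Adj v y := fun y hy hvy =>
      huv' (huv u x v y (.inl rfl) (.inr rfl) hx hy hux hvy).1
    rw [Set.insert_comm]
    refine (h.insert (v := u) fun y hy z hz h1 h2 =>
        (huv u y u z (.inl rfl) (.inl rfl) hy hz h1 h2).2).insert ?_
    rintro y (rfl | hy) z (rfl | hz) h1 h2
    · rfl
    · exact (hv z hz h2).elim
    · exact (hv y hy h1).elim
    · exact (hv y hy h1).elim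
  · push Not at hu
    refine (h.insert (v := v) fun y hy z hz h1 h2 =>
        (huv v y v z (.inr rfl) (.inr rfl) hy hz h1 h2).2).insert ?_
    rintro y (rfl | hy) z (rfl | hz) h1 h2
    · rfl
    · exact (hu z hz h2).elim
    · exact (hu y hy h1).elim
    · exact (hu y hy h1).elim

lemma of_isDegenerate (h : IsDegenerate 1 (G.induce S)) : SpansForest G S := by
  intro T hT hne
  obtain ⟨v, hv, hdeg⟩ := h ((⊤ : (G.induce S).Subgraph).induce {x | x.1 ∈ T})
    (by obtain ⟨x, hx⟩ := hne; exact ⟨⟨x, hT hx⟩, hx⟩)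
  rw [Nat.cast_one, Set.encard_le_one_iff] at hdeg
  refine ⟨v, hv, fun x hx y hy hvx hvy => ?_⟩
  exact congrArg Subtype.val (hdeg ⟨x, hT hx⟩ ⟨y, hT hy⟩ ⟨hv, hx, hvx⟩ ⟨hv, hy, hvy⟩)

lemma isDegenerate (h : SpansForest G S) : IsDegenerate 1 (G.induce S) := by
  intro H hH
  obtain ⟨_, ⟨v, hv, rfl⟩, hv'⟩ := h (Subtype.val '' H.verts)
    (by rintro _ ⟨x, -, rfl⟩; exact x.2) (hH.image _)
  refine ⟨v, hv, ?_⟩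
  rw [Nat.cast_one, Set.encard_le_one_iff]
  intro x y hx hy
  exact Subtype.ext (hv' x ⟨x, H.edge_vert hx.symm, rfl⟩ y ⟨y, H.edge_vert hy.symm, rfl⟩
    (H.adj_sub hx) (H.adj_sub hy))

end SpansForest

/-! ### Partial colourings by acyclic matchings -/

/-- The vertices incident with an edge to which the partial colouring `c` gives colour `a`. -/
def colorSpan {V K : Type*} (c : Sym2 V → Option K) (a : K) : Set V :=
  {v | ∃ w, c s(v, w) = some a}

/-- A partial edge colouring of `G` by acyclic matchings. The value `none` means uncoloured;
pairs of vertices that are not edges stay uncoloured. -/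
structure IsPartialColoring {V K : Type*} (G : SimpleGraph V) (c : Sym2 V → Option K) :
    Prop where
  adj : ∀ {x y a}, c s(x, y) = some a → G.Adj x y
  matching : ∀ {x y z a}, c s(x, y) = some a → c s(x, z) = some a → y = z
  forest : ∀ a, SpansForest G (colorSpan c a)

/-- A partial colouring by acyclic matchings with as many coloured edges as possible. -/
structure IsMaximumColoring {V K : Type*} (G : SimpleGraph V) (c : Sym2 V → Option K) :
    Prop extends IsPartialColoring G c where
  max : ∀ c' : Sym2 V → Option K, IsPartialColoring G c' →
    {e | c' e ≠ none}.ncard ≤ {e | c e ≠ none}.ncard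

section
variable {V K : Type*} {G : SimpleGraph V} {c : Sym2 V → Option K}

open scoped Classical in
lemma IsPartialColoring.erase (h : IsPartialColoring G c) (e : Sym2 V) :
    IsPartialColoring G (Function.update c e none) := by
  have key : ∀ f a, Function.update c e none f = some a → c f = some a := by
    intro f a hf
    by_cases hfe : f = e
    · subst hfe; simp at hf
    · rwa [Function.update_of_ne hfe] at hf
  exact ⟨fun hx => h.adj (key _ _ hx), fun hx hy => h.matching (key _ _ hx) (key _ _ hy),
    fun a => (h.forest a).mono fun v ⟨w, hw⟩ => ⟨w, key _ _ hw⟩⟩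

open scoped Classical in
lemma IsPartialColoring.extend (h : IsPartialColoring G c) {u v : V} {a : K} (huv : G.Adj u v)
    (hu : u ∉ colorSpan c a) (hv : v ∉ colorSpan c a)
    (hF : SpansForest G (insert u (insert v (colorSpan c a)))) :
    IsPartialColoring G (Function.update c s(u, v) (some a)) := by
  have key : ∀ f b, Function.update c s(u, v) (some a) f = some b →
      (f = s(u, v) ∧ b = a) ∨ c f = some b := by
    intro f b hf
    by_cases hfe : f = s(u, v)
    · subst hfe; simp at hf; exact .inl ⟨rfl, hf.symm⟩
    · rw [Function.update_of_ne hfe] at hf; exact .inr hf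
  refine ⟨fun {x y b} hx => ?_, fun {x y z b} hy hz => ?_, fun b => ?_⟩
  · obtain ⟨he, -⟩ | hx := key _ _ hx
    · rw [← SimpleGraph.mem_edgeSet, he]; exact huv
    · exact h.adj hx
  · obtain ⟨he, hb⟩ | hy' := key _ _ hy <;> obtain ⟨he', hb'⟩ | hz' := key _ _ hz
    · rw [← he'] at he
      exact Sym2.congr_right.1 he
    · subst hb
      obtain ⟨rfl, rfl⟩ | ⟨rfl, rfl⟩ := Sym2.eq_iff.1 he
      · exact (hu ⟨_, hz'⟩).elim
      · exact (hv ⟨_, hz'⟩).elim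
    · subst hb'
      obtain ⟨rfl, rfl⟩ | ⟨rfl, rfl⟩ := Sym2.eq_iff.1 he'
      · exact (hu ⟨_, hy'⟩).elim
      · exact (hv ⟨_, hy'⟩).elim
    · exact h.matching hy' hz'
  · by_cases hb : b = a
    · subst hb
      refine hF.mono ?_
      rintro x ⟨y, hxy⟩
      obtain ⟨he, -⟩ | hxy := key _ _ hxy
      · obtain ⟨rfl, rfl⟩ | ⟨rfl, rfl⟩ := Sym2.eq_iff.1 he <;> simp
      · exact .inr (.inr ⟨y, hxy⟩)
    · refine (h.forest b).mono ?_
      rintro x ⟨y, hxy⟩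
      obtain ⟨-, he⟩ | hxy := key _ _ hxy
      · exact (hb he).elim
      · exact ⟨y, hxy⟩

end

/-! ### Double counting around an uncoloured edge -/

/-- For an edge `uv`: the ordered pair `(s, y)` is an edge `sy` other than `uv` with `s = u` or
`s = v`. A common neighbour `y` of `u` and `v` gives two such pairs. -/
def IsSideEdge {V : Type*} (G : SimpleGraph V) (u v s y : V) : Prop :=
  G.Adj s y ∧ (s = u ∧ y ≠ v ∨ s = v ∧ y ≠ u)

section
variable {V K : Type*} [Fintype V] {G : SimpleGraph V} {c : Sym2 V → Option K}

open scoped Classical in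
/-- In a maximum colouring, no colour can be given to an uncoloured edge. -/
lemma IsMaximumColoring.not_extend (h : IsMaximumColoring G c) {u v : V} {a : K}
    (h0 : c s(u, v) = none) (huv : G.Adj u v)
    (hu : u ∉ colorSpan c a) (hv : v ∉ colorSpan c a) :
    ¬ SpansForest G (insert u (insert v (colorSpan c a))) := by
  intro hF
  have h1 := h.max _ (h.extend huv hu hv hF)
  have h2 : {e | Function.update c s(u, v) (some a) e ≠ none} =
      insert s(u, v) {e | c e ≠ none} := by
    ext e
    by_cases he : e = s(u, v) <;> simp [he]
  rw [h2, Set.ncard_insert_of_notMem (by simp [h0])] at h1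
  omega

/-- Every colour that does not occur on an edge adjacent to the uncoloured edge `uv` of a maximum
colouring occurs at the far ends of two side edges. -/
lemma IsMaximumColoring.exists_two (h : IsMaximumColoring G c) {u v : V} {a : K}
    (h0 : c s(u, v) = none) (huv : G.Adj u v)
    (hu : u ∉ colorSpan c a) (hv : v ∉ colorSpan c a) :
    ∃ s x t y, IsSideEdge G u v s x ∧ IsSideEdge G u v t y ∧ x ∈ colorSpan c a ∧
      y ∈ colorSpan c a ∧ (s, x) ≠ (t, y) := by
  by_contra! hcon
  refine h.not_extend h0 huv hu hv ((h.forest a).insert_pair ?_)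
  have side : ∀ s x, (s = u ∨ s = v) → x ∈ colorSpan c a → G.Adj s x →
      IsSideEdge G u v s x := by
    rintro s x (rfl | rfl) hx hsx
    · exact ⟨hsx, .inl ⟨rfl, fun e => hv (e ▸ hx)⟩⟩
    · exact ⟨hsx, .inr ⟨rfl, fun e => hu (e ▸ hx)⟩⟩
  intro s x t y hs ht hx hy hsx hty
  exact Prod.ext_iff.1 (hcon s x t y (side s x hs hx hsx) (side t y ht hy hty) hx hy)

end

/-- The structure around an uncoloured edge `uv` of a maximum colouring with `Δ ^ 2 - 1` colours. -/
structure IsTightHole {V K : Type*} [Fintype V] (G : SimpleGraph V) [DecidableRel G.Adj]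
    (Δ : ℕ) (c : Sym2 V → Option K) (u v : V) : Prop where
  degree_left : G.degree u = Δ
  degree_right : G.degree v = Δ
  colored : ∀ {s y}, IsSideEdge G u v s y → ∃ p, c s(s, y) = some p
  /-- A colour of a side edge is not seen from any other side edge. -/
  unique : ∀ {s y t z p}, IsSideEdge G u v s y → IsSideEdge G u v t z → c s(s, y) = some p →
    z ∈ colorSpan c p → (s, y) = (t, z)
  /-- No colour is seen from three side edges. -/
  two : ∀ {s₁ y₁ s₂ y₂ s₃ y₃ p}, IsSideEdge G u v s₁ y₁ → IsSideEdge G u v s₂ y₂ →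
    IsSideEdge G u v s₃ y₃ → y₁ ∈ colorSpan c p → y₂ ∈ colorSpan c p → y₃ ∈ colorSpan c p →
    (s₁, y₁) = (s₂, y₂) ∨ (s₁, y₁) = (s₃, y₃) ∨ (s₂, y₂) = (s₃, y₃)

section
variable {V : Type*} [Fintype V] {G : SimpleGraph V} [DecidableRel G.Adj] {Δ : ℕ}
  {c : Sym2 V → Option (Fin (Δ ^ 2 - 1))} {u v w x : V}

open scoped Classical in
lemma IsPartialColoring.card_colors_le {K : Type*} [Fintype K] {c : Sym2 V → Option K}
    (h : IsPartialColoring G c) (y : V) :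
    (Finset.univ.filter fun a => y ∈ colorSpan c a).card ≤ G.degree y := by
  have : Nonempty V := ⟨y⟩
  choose! f hf using fun (a : K) (ha : y ∈ colorSpan c a) => ha
  rw [← G.card_neighborFinset_eq_degree]
  refine Finset.card_le_card_of_injOn f (fun a ha => ?_) (fun a ha b hb hab => ?_)
  · simp only [Finset.coe_filter, Finset.mem_univ, true_and, Set.mem_ofPred_eq] at ha
    simpa using h.adj (hf a ha)
  · simp only [Finset.coe_filter, Finset.mem_univ, true_and, Set.mem_ofPred_eq] at ha hb
    have h1 := hf a ha
    rw [hab, hf b hb] at h1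
    exact (Option.some.inj h1).symm

open scoped Classical in
lemma card_sideEdges_le (huv : G.Adj u v) :
    (Finset.univ.filter fun b : V × V => IsSideEdge G u v b.1 b.2).card ≤
      (G.degree u - 1) + (G.degree v - 1) := by
  have hsub : (Finset.univ.filter fun b : V × V => IsSideEdge G u v b.1 b.2) ⊆
      ((G.neighborFinset u).erase v).image (fun y => (u, y)) ∪
        ((G.neighborFinset v).erase u).image (fun y => (v, y)) := by
    rintro ⟨s, y⟩ hb
    obtain ⟨hsy, ⟨rfl, hy⟩ | ⟨rfl, hy⟩⟩ := (Finset.mem_filter.1 hb).2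
    · simp only [Finset.mem_union, Finset.mem_image]
      exact .inl ⟨y, by simpa [hy] using hsy, rfl⟩
    · simp only [Finset.mem_union, Finset.mem_image]
      exact .inr ⟨y, by simpa [hy] using hsy, rfl⟩
  refine (Finset.card_le_card hsub).trans ((Finset.card_union_le _ _).trans ?_)
  refine (Nat.add_le_add Finset.card_image_le Finset.card_image_le).trans ?_
  rw [Finset.card_erase_of_mem (by simpa using huv),
    Finset.card_erase_of_mem (by simpa using huv.symm)]
  simp

open scoped Classical in
/-- Double counting. Give a colour one unit of weight for every side edge at whose far end it
occurs, and one more unit for every side edge that has this colour. A colour that is unavailable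
for `uv` has weight at least two, while the total weight is at most `2 * (Δ ^ 2 - 1)`, so all
estimates are equalities. -/
lemma IsMaximumColoring.isTightHole (h : IsMaximumColoring G c) (hpos : 1 ≤ Δ)
    (hΔ : ∀ x, G.degree x ≤ Δ) (h0 : c s(u, v) = none) (huv : G.Adj u v) :
    IsTightHole G Δ c u v := by
  set B := Finset.univ.filter fun b : V × V => IsSideEdge G u v b.1 b.2 with hB
  have memB : ∀ {s y}, IsSideEdge G u v s y → (s, y) ∈ B := fun hs => by simp [hB, hs]
  set far : Fin (Δ ^ 2 - 1) → Finset (V × V) := fun a => B.filter fun b => b.2 ∈ colorSpan c a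
    with hfar
  set own : Fin (Δ ^ 2 - 1) → Finset (V × V) :=
    fun a => B.filter fun b => c s(b.1, b.2) = some a with hown
  have hpos' : ∀ {s y a}, IsSideEdge G u v s y → c s(s, y) = some a →
      (s, y) ∈ far a ∧ (s, y) ∈ own a := by
    intro s y a hs ha
    simp only [hfar, hown, Finset.mem_filter]
    exact ⟨⟨memB hs, s, by rwa [Sym2.eq_swap]⟩, memB hs, ha⟩
  have weight_ge : ∀ a, 2 ≤ (far a).card + (own a).card := by
    intro a
    by_cases hex : ∃ s y, IsSideEdge G u v s y ∧ c s(s, y) = some a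
    · obtain ⟨s, y, hs, ha⟩ := hex
      have h1 := Finset.card_pos.2 ⟨_, (hpos' hs ha).1⟩
      have h2 := Finset.card_pos.2 ⟨_, (hpos' hs ha).2⟩
      omega
    · have hu : u ∉ colorSpan c a := fun ⟨y, hy⟩ => hex ⟨u, y, ⟨h.adj hy, .inl ⟨rfl, by
        rintro rfl; simp [h0] at hy⟩⟩, hy⟩
      have hv : v ∉ colorSpan c a := fun ⟨y, hy⟩ => hex ⟨v, y, ⟨h.adj hy, .inr ⟨rfl, by
        rintro rfl; rw [Sym2.eq_swap] at hy; simp [h0] at hy⟩⟩, hy⟩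
      obtain ⟨s, x, t, y, hs, ht, hx, hy, hne⟩ := h.exists_two h0 huv hu hv
      have : 1 < (far a).card := Finset.one_lt_card.2 ⟨_, Finset.mem_filter.2 ⟨memB hs, hx⟩,
        _, Finset.mem_filter.2 ⟨memB ht, hy⟩, hne⟩
      omega
  set load : V × V → ℕ := fun b =>
    (Finset.univ.filter fun a => b.2 ∈ colorSpan c a).card +
      (Finset.univ.filter fun a => c s(b.1, b.2) = some a).card with hload
  have own_le : ∀ b : V × V, (Finset.univ.filter fun a => c s(b.1, b.2) = some a).card ≤ 1 := by
    intro b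
    refine Finset.card_le_one.2 fun a ha a' ha' => ?_
    have h1 := (Finset.mem_filter.1 ha).2
    rw [(Finset.mem_filter.1 ha').2] at h1
    exact (Option.some.inj h1).symm
  have load_le : ∀ b ∈ B, load b ≤ Δ + 1 := fun b _ =>
    Nat.add_le_add ((h.card_colors_le b.2).trans (hΔ _)) (own_le b)
  have hsum : ∑ a, ((far a).card + (own a).card) = ∑ b ∈ B, load b := by
    simp only [hfar, hown, hload, Finset.card_filter, Finset.sum_add_distrib]
    rw [Finset.sum_comm, Finset.sum_comm (s := Finset.univ)]
  have hBcard : B.card ≤ _ := card_sideEdges_le huv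
  have hge : ∑ _a : Fin (Δ ^ 2 - 1), 2 ≤ ∑ a, ((far a).card + (own a).card) :=
    Finset.sum_le_sum fun a _ => weight_ge a
  have hle : ∑ b ∈ B, load b ≤ ∑ _b ∈ B, (Δ + 1) := Finset.sum_le_sum load_le
  have e1 : ∑ _a : Fin (Δ ^ 2 - 1), 2 = 2 * (Δ - 1) * (Δ + 1) := by
    obtain ⟨d, rfl⟩ := Nat.exists_eq_add_of_le hpos
    have : (1 + d) ^ 2 - 1 = d * (d + 2) := by
      rw [Nat.sub_eq_iff_eq_add (Nat.one_le_pow _ _ (by omega))]; ring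
    simp only [Finset.sum_const, Finset.card_univ, Fintype.card_fin, smul_eq_mul, this]
    rw [Nat.add_sub_cancel_left]; ring
  have e2 : ∑ _b ∈ B, (Δ + 1) = B.card * (Δ + 1) := by simp
  have hlow : 2 * (Δ - 1) ≤ B.card := by
    refine Nat.le_of_mul_le_mul_right (c := Δ + 1) ?_ (by omega)
    rw [← e1, ← e2]; omega
  have hdu : 0 < G.degree u := (G.degree_pos_iff_exists_adj u).2 ⟨v, huv⟩
  have hdv : 0 < G.degree v := (G.degree_pos_iff_exists_adj v).2 ⟨u, huv.symm⟩
  have hu := hΔ u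
  have hv := hΔ v
  have hBeq : B.card = 2 * (Δ - 1) := by omega
  rw [hBeq] at e2
  have heq1 : ∀ a, (far a).card + (own a).card = 2 := by
    have := (Finset.sum_eq_sum_iff_of_le (fun a _ => weight_ge a)).1
      (show ∑ _a : Fin (Δ ^ 2 - 1), 2 = _ by omega)
    exact fun a => (this a (Finset.mem_univ a)).symm
  have heq2 : ∀ b ∈ B, load b = Δ + 1 :=
    (Finset.sum_eq_sum_iff_of_le load_le).1 (by omega)
  refine ⟨by omega, by omega, fun {s y} hs => ?_, fun {s y t z p} hs ht hp hz => ?_,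
    fun {s₁ y₁ s₂ y₂ s₃ y₃ p} h₁ h₂ h₃ hy₁ hy₂ hy₃ => ?_⟩
  · have h1 := heq2 _ (memB hs)
    have h2 := (h.card_colors_le y).trans (hΔ _)
    simp only [hload] at h1
    obtain ⟨p, hp⟩ := Finset.card_pos.1 (show 0 < (Finset.univ.filter
      fun a => c s(s, y) = some a).card by omega)
    exact ⟨p, (Finset.mem_filter.1 hp).2⟩
  · by_contra hne
    have h1 := Finset.card_pos.2 ⟨_, (hpos' hs hp).2⟩
    have h2 : 1 < (far p).card := Finset.one_lt_card.2 ⟨_, (hpos' hs hp).1, _,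
      Finset.mem_filter.2 ⟨memB ht, hz⟩, hne⟩
    have := heq1 p
    omega
  · by_contra! hne
    have h2 : 2 < (far p).card := Finset.two_lt_card.2 ⟨_, Finset.mem_filter.2 ⟨memB h₁, hy₁⟩,
      _, Finset.mem_filter.2 ⟨memB h₂, hy₂⟩, _, Finset.mem_filter.2 ⟨memB h₃, hy₃⟩, hne⟩
    have := heq1 p
    omega

/-! ### Moving the hole -/

/-- The ends of a hole have no common neighbour. -/
lemma IsTightHole.not_adj {K : Type*} {c : Sym2 V → Option K} (h : IsTightHole G Δ c u v)
    (huv : G.Adj u v) (huw : G.Adj u w) : ¬ G.Adj v w := by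
  intro hvw
  have h1 : IsSideEdge G u v u w := ⟨huw, .inl ⟨rfl, hvw.ne'⟩⟩
  obtain ⟨p, hp⟩ := h.colored h1
  have := h.unique h1 ⟨hvw, .inr ⟨rfl, huw.ne'⟩⟩ hp ⟨u, by rwa [Sym2.eq_swap]⟩
  exact huv.ne (Prod.ext_iff.1 this).1

open scoped Classical in
/-- After its own edge `uw` is uncoloured, the colour of `uw` does not occur within distance one
of the uncoloured edge `uv`. -/
lemma IsTightHole.far_of_mem_colorSpan {K : Type*} {c : Sym2 V → Option K} {p : K} {z : V}
    (ht : IsTightHole G Δ c u v) (h : IsPartialColoring G c) (h0 : c s(u, v) = none)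
    (huv : G.Adj u v) (hwv : w ≠ v) (hp : c s(u, w) = some p)
    (hz : z ∈ colorSpan (Function.update c s(u, w) none) p) :
    z ≠ u ∧ z ≠ v ∧ ¬ G.Adj u z ∧ ¬ G.Adj v z := by
  obtain ⟨t, hzt⟩ := hz
  have hne : s(z, t) ≠ s(u, w) := by
    intro he; simp [he] at hzt
  rw [Function.update_of_ne hne] at hzt
  have hside : IsSideEdge G u v u w := ⟨h.adj hp, .inl ⟨rfl, hwv⟩⟩
  refine ⟨?_, ?_, fun huz => ?_, fun hvz => ?_⟩
  · rintro rfl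
    exact hne (by rw [h.matching hzt hp])
  · rintro rfl
    have htu : t ≠ u := by
      rintro rfl; rw [Sym2.eq_swap, h0] at hzt; simp at hzt
    have := ht.unique hside ⟨h.adj hzt, .inr ⟨rfl, htu⟩⟩ hp ⟨z, by rwa [Sym2.eq_swap]⟩
    exact huv.ne (Prod.ext_iff.1 this).1
  · by_cases hzv : z = v
    · subst hzv
      have htu : t ≠ u := by
        rintro rfl; rw [Sym2.eq_swap, h0] at hzt; simp at hzt
      have := ht.unique hside ⟨h.adj hzt, .inr ⟨rfl, htu⟩⟩ hp ⟨z, by rwa [Sym2.eq_swap]⟩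
      exact huv.ne (Prod.ext_iff.1 this).1
    have := (Prod.ext_iff.1 (ht.unique hside ⟨huz, .inl ⟨rfl, hzv⟩⟩ hp ⟨t, hzt⟩)).2
    simp only at this
    subst this
    exact hne (by rw [h.matching hzt (show c s(w, u) = some p by rwa [Sym2.eq_swap]),
      Sym2.eq_swap])
  · by_cases hzu : z = u
    · subst hzu
      exact hne (by rw [h.matching hzt hp])
    exact huv.ne (Prod.ext_iff.1
      (ht.unique hside ⟨hvz, .inr ⟨rfl, hzu⟩⟩ hp ⟨t, hzt⟩)).1

open scoped Classical in
/-- The hole of a maximum colouring can be moved to any adjacent edge, by giving the colour of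
that edge to the hole. -/
lemma IsMaximumColoring.shift {K : Type*} {c : Sym2 V → Option K} {p : K}
    (h : IsMaximumColoring G c) (ht : IsTightHole G Δ c u v) (h0 : c s(u, v) = none)
    (huv : G.Adj u v) (hwv : w ≠ v) (hp : c s(u, w) = some p) :
    IsMaximumColoring G
      (Function.update (Function.update c s(u, w) none) s(u, v) (some p)) := by
  have far := fun z => ht.far_of_mem_colorSpan (z := z) h.toIsPartialColoring h0 huv hwv hp
  have h1 := h.toIsPartialColoring.erase s(u, w)
  refine ⟨h1.extend huv (fun hu => (far _ hu).1 rfl) (fun hv => (far _ hv).2.1 rfl)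
    ((h1.forest p).insert_pair ?_), fun c' hc' => (h.max c' hc').trans_eq ?_⟩
  · rintro s x - - (rfl | rfl) - hx - hsx -
    · exact ((far _ hx).2.2.1 hsx).elim
    · exact ((far _ hx).2.2.2 hsx).elim
  · have hset : {e | Function.update (Function.update c s(u, w) none) s(u, v) (some p) e ≠ none} =
        insert s(u, v) ({e | c e ≠ none} \ {s(u, w)}) := by
      ext e
      by_cases h1 : e = s(u, v)
      · simp [h1]
      · by_cases h2 : e = s(u, w)
        · subst h2
          rw [Set.mem_ofPred_eq, Function.update_of_ne h1]
          simp [h1]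
        · simp [h1, h2]
    rw [hset, Set.ncard_exchange (by simp [h0]) (by simp [hp])]

open scoped Classical in
/-- The neighbours of a neighbour of `u` are neighbours of `v`, for a hole `uv`: otherwise the hole
can be moved to an edge `wx` with `x` not adjacent to `v`, and then the former colour of `uw`,
which has become the colour of `uv`, can be given to `wx`, because `uv` is a pendant piece of the
subgraph spanned by that colour. -/
lemma IsMaximumColoring.adj_of_adj_adj (h : IsMaximumColoring G c) (hpos : 1 ≤ Δ)
    (hΔ : ∀ x, G.degree x ≤ Δ) (h0 : c s(u, v) = none) (huv : G.Adj u v) (huw : G.Adj u w) :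
    G.degree w = Δ ∧ ∀ x, G.Adj w x → G.Adj v x := by
  have t := h.isTightHole hpos hΔ h0 huv
  by_cases hwv : w = v
  · subst hwv; exact ⟨t.degree_right, fun _ hx => hx⟩
  obtain ⟨p, hp⟩ := t.colored (s := u) (y := w) ⟨huw, .inl ⟨rfl, hwv⟩⟩
  have far := fun z => t.far_of_mem_colorSpan (z := z) h.toIsPartialColoring h0 huv hwv hp
  have hF := (h.toIsPartialColoring.erase s(u, w)).forest p
  have h₁ := h.shift t h0 huv hwv hp
  set c₀ := Function.update c s(u, w) none with hc₀
  set c₁ := Function.update c₀ s(u, v) (some p) with hc₁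
  have hole₁ : c₁ s(w, u) = none := by
    rw [hc₁, hc₀, Sym2.eq_swap, Function.update_of_ne (by simp [hwv, huw.ne']), Function.update_self]
  have t₁ := h₁.isTightHole hpos hΔ hole₁ huw.symm
  refine ⟨t₁.degree_left, fun x hwx => ?_⟩
  by_cases hxu : x = u
  · subst hxu; exact huv.symm
  by_contra hvx
  obtain ⟨a, ha⟩ := t₁.colored (s := w) (y := x) ⟨hwx, .inl ⟨rfl, hxu⟩⟩
  have h₂ := h₁.shift t₁ hole₁ huw.symm hxu ha
  set c₂ := Function.update (Function.update c₁ s(w, x) none) s(w, u) (some a) with hc₂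
  have e1 : s(w, x) ≠ s(u, v) := by
    intro e
    obtain ⟨e, -⟩ | ⟨e, -⟩ := Sym2.eq_iff.1 e
    · exact huw.ne' e
    · exact hwv e
  have e2 : s(w, x) ≠ s(u, w) := by
    rw [Sym2.eq_swap (a := u)]; simp [hxu, huw.ne']
  have e3 : s(u, v) ≠ s(w, u) := by
    rw [Sym2.eq_swap (a := w)]; simp [Ne.symm hwv, huw.ne]
  have hcwx : c s(w, x) = some a := by
    rwa [hc₁, hc₀, Function.update_of_ne e1, Function.update_of_ne e2] at ha
  have hap : a ≠ p := by
    rintro rfl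
    exact hxu (h.matching hcwx (by rwa [Sym2.eq_swap]))
  have hole₂ : c₂ s(w, x) = none := by
    rw [hc₂, Function.update_of_ne (by simp [hxu, huw.ne']), Function.update_self]
  have c₂wu : c₂ s(w, u) = some a := by rw [hc₂, Function.update_self]
  have c₂uv : c₂ s(u, v) = some p := by
    rw [hc₂, Function.update_of_ne e3, Function.update_of_ne e1.symm, hc₁, Function.update_self]
  have c₂_other : ∀ e, e ≠ s(u, v) → e ≠ s(w, u) → e ≠ s(w, x) → c₂ e = c₀ e := by
    intro e h1 h2 h3
    rw [hc₂, Function.update_of_ne h2, Function.update_of_ne h3, hc₁, Function.update_of_ne h1]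
  have t₂ := h₂.isTightHole hpos hΔ hole₂ hwx
  -- In `c₂` the colour `p` occurs on `uv` and on the edges that have it in `c₀`.
  have span_sub : colorSpan c₂ p ⊆ insert v (insert u (colorSpan c₀ p)) := by
    rintro z ⟨y, hy⟩
    by_cases h1 : s(z, y) = s(u, v)
    · obtain ⟨rfl, -⟩ | ⟨rfl, -⟩ := Sym2.eq_iff.1 h1 <;> simp
    · rw [c₂_other _ h1 (by rintro e; rw [e, c₂wu] at hy; exact hap (Option.some.inj hy))
        (by rintro e; rw [e, hole₂] at hy; simp at hy)] at hy
      exact .inr (.inr ⟨y, hy⟩)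
  have span_sup : colorSpan c₀ p ⊆ colorSpan c₂ p := by
    rintro z ⟨y, hy⟩
    refine ⟨y, ?_⟩
    rwa [c₂_other]
    · intro e
      rw [e, hc₀, Function.update_of_ne (by simp [Ne.symm hwv, huw.ne]), h0] at hy
      simp at hy
    · intro e
      rw [e, hc₀, Sym2.eq_swap, Function.update_self] at hy
      simp at hy
    · intro e
      rw [e, hc₀, Function.update_of_ne e2, hcwx] at hy
      exact hap (Option.some.inj hy)
  have hu : u ∈ colorSpan c₂ p := ⟨v, c₂uv⟩
  have side_u : IsSideEdge G w x w u := ⟨huw.symm, .inl ⟨rfl, Ne.symm hxu⟩⟩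
  have hw : w ∉ colorSpan c₂ p := by
    rintro ⟨y, hy⟩
    have hyx : y ≠ x := by rintro rfl; simp [hole₂] at hy
    have := (Prod.ext_iff.1 (t₂.unique ⟨h₂.adj hy, .inl ⟨rfl, hyx⟩⟩ side_u hy hu)).2
    simp only at this
    rw [this, c₂wu] at hy
    exact hap (Option.some.inj hy)
  have hx : x ∉ colorSpan c₂ p := by
    rintro ⟨y, hy⟩
    have hyw : y ≠ w := by rintro rfl; rw [Sym2.eq_swap] at hy; simp [hole₂] at hy
    exact hwx.ne'
      (Prod.ext_iff.1 (t₂.unique ⟨h₂.adj hy, .inr ⟨rfl, hyw⟩⟩ side_u hy hu)).1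
  have side : ∀ s y, (s = w ∨ s = x) → y ∈ colorSpan c₀ p → G.Adj s y →
      IsSideEdge G w x s y := by
    rintro s y (rfl | rfl) hy hsy
    · exact ⟨hsy, .inl ⟨rfl, fun e => hx (e ▸ span_sup hy)⟩⟩
    · exact ⟨hsy, .inr ⟨rfl, fun e => hw (e ▸ span_sup hy)⟩⟩
  -- The colour `p` is seen from at most two side edges of the hole `wx`. One of them is `wu`, and
  -- `u` is not in the span of `p` in `c₀`, so at most one edge joins `w` or `x` to that span.
  have hF₁ : SpansForest G (insert w (insert x (colorSpan c₀ p))) := by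
    refine hF.insert_pair fun s y s' y' hs hs' hy hy' hsy hsy' => ?_
    obtain h1 | h1 | h1 := t₂.two side_u (side s y hs hy hsy) (side s' y' hs' hy' hsy') hu
      (span_sup hy) (span_sup hy')
    · exact ((far _ hy).1 (Prod.ext_iff.1 h1).2.symm).elim
    · exact ((far _ hy').1 (Prod.ext_iff.1 h1).2.symm).elim
    · exact Prod.ext_iff.1 h1
  have hux : ¬ G.Adj u x := t₁.not_adj huw.symm hwx
  have hvw : ¬ G.Adj v w := t.not_adj huv huw
  have only_w : ∀ y ∈ insert w (insert x (colorSpan c₀ p)), G.Adj u y → y = w := by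
    rintro y (rfl | rfl | hy) huy
    · rfl
    · exact (hux huy).elim
    · exact ((far _ hy).2.2.1 huy).elim
  have only_u : ∀ y ∈ insert u (insert w (insert x (colorSpan c₀ p))), G.Adj v y → y = u := by
    rintro y (rfl | rfl | rfl | hy) hvy
    · rfl
    · exact (hvw hvy).elim
    · exact (hvx hvy).elim
    · exact ((far _ hy).2.2.2 hvy).elim
  -- `u` and `v` are restored as leaves, in this order.
  have hF₂ := (hF₁.insert fun y hy z hz h1 h2 =>
      (only_w y hy h1).trans (only_w z hz h2).symm).insert fun y hy z hz h1 h2 =>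
      (only_u y hy h1).trans (only_u z hz h2).symm
  refine h₂.not_extend hole₂ hwx hw hx (hF₂.mono ?_)
  rintro z (rfl | rfl | hz)
  · simp
  · simp
  · obtain rfl | rfl | hz := span_sub hz
    · simp
    · simp
    · simp [hz]

/-- A neighbour of one end `u` of a hole has the same neighbours as the other end `v`. -/
lemma IsMaximumColoring.adj_iff (h : IsMaximumColoring G c) (hpos : 1 ≤ Δ)
    (hΔ : ∀ x, G.degree x ≤ Δ) (h0 : c s(u, v) = none) (huv : G.Adj u v) (huw : G.Adj u w) :
    G.Adj w x ↔ G.Adj v x := by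
  obtain ⟨hdeg, hsub⟩ := h.adj_of_adj_adj hpos hΔ h0 huv huw
  have heq : G.neighborFinset w = G.neighborFinset v := by
    refine Finset.eq_of_subset_of_card_le (fun y hy => ?_) ?_
    · simpa using hsub y (by simpa using hy)
    · rw [G.card_neighborFinset_eq_degree, G.card_neighborFinset_eq_degree, hdeg]
      exact hΔ v
  rw [← G.mem_neighborFinset, heq, G.mem_neighborFinset]

lemma IsMaximumColoring.nonempty_iso (h : IsMaximumColoring G c) (hG : G.Connected)
    (hpos : 1 ≤ Δ) (hΔ : ∀ x, G.degree x ≤ Δ) (h0 : c s(u, v) = none) (huv : G.Adj u v) :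
    Nonempty (G ≃g completeBipartiteGraph (Fin Δ) (Fin Δ)) := by
  have t := h.isTightHole hpos hΔ h0 huv
  have hu : ∀ {w x}, G.Adj u w → (G.Adj w x ↔ G.Adj v x) :=
    fun huw => h.adj_iff hpos hΔ h0 huv huw
  have hv : ∀ {w x}, G.Adj v w → (G.Adj w x ↔ G.Adj u x) :=
    fun hvw => h.adj_iff hpos hΔ (by rwa [Sym2.eq_swap]) huv.symm hvw
  have hcover : ∀ z, G.Adj u z ∨ G.Adj v z := by
    intro z
    have hz := (G.reachable_iff_reflTransGen u z).1 (hG.preconnected u z)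
    induction hz with
    | refl => exact .inr huv.symm
    | tail _ hyz ih => exact ih.symm.imp (fun h => (hv h).1 hyz) (fun h => (hu h).1 hyz)
  let e₁ : G.neighborSet u ≃ Fin Δ :=
    Fintype.equivFinOfCardEq ((G.card_neighborSet_eq_degree u).trans t.degree_left)
  let e₂ : G.neighborSet v ≃ Fin Δ :=
    Fintype.equivFinOfCardEq ((G.card_neighborSet_eq_degree v).trans t.degree_right)
  let E : G.neighborSet u ⊕ G.neighborSet v ≃ V :=
    Equiv.ofBijective (Sum.elim Subtype.val Subtype.val) <| by
      constructor
      · rintro (⟨x, hx⟩ | ⟨x, hx⟩) (⟨y, hy⟩ | ⟨y, hy⟩) hxy <;> simp only [Sum.elim_inl,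
          Sum.elim_inr] at hxy <;> subst hxy
        · rfl
        · exact (t.not_adj huv hx hy).elim
        · exact (t.not_adj huv hy hx).elim
        · rfl
      · intro z
        obtain hz | hz := hcover z
        · exact ⟨.inl ⟨z, hz⟩, rfl⟩
        · exact ⟨.inr ⟨z, hz⟩, rfl⟩
  have hE : ∀ x y, G.Adj (E x) (E y) ↔
      (completeBipartiteGraph (G.neighborSet u) (G.neighborSet v)).Adj x y := by
    rintro (⟨x, hx⟩ | ⟨x, hx⟩) (⟨y, hy⟩ | ⟨y, hy⟩)
    · exact iff_of_false (fun hxy => t.not_adj huv hy ((hu hx).1 hxy)) (by simp)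
    · exact iff_of_true ((hu hx).2 hy) (by simp)
    · exact iff_of_true ((hv hx).2 hy) (by simp)
    · exact iff_of_false (fun hxy => t.not_adj huv ((hv hx).1 hxy) hy) (by simp)
  refine ⟨⟨E.symm.trans (Equiv.sumCongr e₁ e₂), fun {x y} => ?_⟩⟩
  obtain ⟨x, rfl⟩ := E.surjective x
  obtain ⟨y, rfl⟩ := E.surjective y
  rw [hE]
  obtain x | x := x <;> obtain y | y := y <;> simp

end

/-! ### Total colourings and complete bipartite graphs -/

section
variable {V : Type*} {G : SimpleGraph V}

lemma exists_isMaximumColoring [Fintype V] (G : SimpleGraph V) (K : Type*) [Finite K] :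
    ∃ c : Sym2 V → Option K, IsMaximumColoring G c := by
  obtain ⟨c, hc, hmax⟩ := Set.exists_max_image {c : Sym2 V → Option K | IsPartialColoring G c}
    (fun c => {e | c e ≠ none}.ncard) (Set.toFinite _)
    ⟨fun _ => none, fun h => by simp at h, fun h => by simp at h, fun a T hT ⟨x, hx⟩ => by
      obtain ⟨y, hy⟩ := hT hx
      simp at hy⟩
  exact ⟨c, ⟨hc, hmax⟩⟩

/-- A partial colouring that colours all edges is a 1-degenerate edge colouring. -/
lemma IsPartialColoring.exists_isDegenerateEdgeColoring {K : Type*} {c : Sym2 V → Option K}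
    (h : IsPartialColoring G c) (hall : ∀ e ∈ G.edgeSet, c e ≠ none) :
    ∃ c' : G.edgeSet → K, IsDegenerateEdgeColoring 1 G c' := by
  choose f hf using fun e : G.edgeSet => Option.ne_none_iff_exists'.1 (hall e e.2)
  have hclass : ∀ a, ∀ e ∈ colorClass G f a, c e = some a := by
    rintro a e ⟨he, rfl⟩; exact hf ⟨e, he⟩
  refine ⟨f, fun a => ⟨⟨fun e he => he.1, ?_⟩, ?_⟩⟩
  · rintro e he e' he' hne v ⟨hve, hve'⟩
    obtain ⟨x, rfl⟩ := hve
    obtain ⟨y, rfl⟩ := hve'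
    exact hne (by rw [h.matching (hclass a _ he) (hclass a _ he')])
  · refine ((h.forest a).mono ?_).isDegenerate
    rintro v ⟨e, he, x, rfl⟩
    exact ⟨x, hclass a _ he⟩

lemma isDegenerateEdgeColoring_of_injective {K : Type*} {c : G.edgeSet → K}
    (hc : Function.Injective c) : IsDegenerateEdgeColoring 1 G c := by
  have huniq : ∀ a, ∀ e ∈ colorClass G c a, ∀ f ∈ colorClass G c a, e = f := by
    rintro a e ⟨he, rfl⟩ f ⟨hf, hfe⟩
    exact congrArg Subtype.val (hc hfe).symm
  refine fun a => ⟨⟨fun e he => he.1, fun e he f hf hne => (hne (huniq a e he f hf)).elim⟩,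
    SpansForest.isDegenerate ?_⟩
  rintro T hT ⟨v, hv⟩
  refine ⟨v, hv, fun x hx y hy hvx hvy => ?_⟩
  obtain ⟨e, he, hve⟩ := hT hv
  obtain ⟨f, hf, hxf⟩ := hT hx
  obtain ⟨g, hg, hyg⟩ := hT hy
  rw [← huniq a e he f hf] at hxf
  rw [← huniq a e he g hg] at hyg
  have h1 := (Sym2.mem_and_mem_iff hvx.ne).1 ⟨hve, hxf⟩
  have h2 := (Sym2.mem_and_mem_iff hvy.ne).1 ⟨hve, hyg⟩
  exact Sym2.congr_right.1 (h1.symm.trans h2)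

lemma adj_symm_of_iso {α β : Type*} (φ : G ≃g completeBipartiteGraph α β) (i : α) (j : β) :
    G.Adj (φ.symm (.inl i)) (φ.symm (.inr j)) := by
  rw [φ.symm.map_adj_iff]; simp

lemma exists_eq_of_mem_edgeSet {α β : Type*} (φ : G ≃g completeBipartiteGraph α β)
    {e : Sym2 V} (he : e ∈ G.edgeSet) :
    ∃ i j, e = s(φ.symm (.inl i), φ.symm (.inr j)) := by
  induction e with | _ x y
  obtain ⟨x, rfl⟩ := φ.symm.surjective x
  obtain ⟨y, rfl⟩ := φ.symm.surjective y
  rw [SimpleGraph.mem_edgeSet, φ.symm.map_adj_iff] at he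
  obtain i | i := x <;> obtain j | j := y
  · simp at he
  · exact ⟨i, j, rfl⟩
  · exact ⟨j, i, Sym2.eq_swap⟩
  · simp at he

/-- Two disjoint edges of a complete bipartite graph span a 4-cycle. -/
lemma injective_of_isDegenerateEdgeColoring {α β K : Type*}
    (φ : G ≃g completeBipartiteGraph α β) {c : G.edgeSet → K}
    (hc : IsDegenerateEdgeColoring 1 G c) : Function.Injective c := by
  have hadj := adj_symm_of_iso φ
  have hform : ∀ e ∈ G.edgeSet, ∃ i j, e = s(φ.symm (.inl i), φ.symm (.inr j)) :=
    fun _ he => exists_eq_of_mem_edgeSet φ he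
  rintro ⟨e, he⟩ ⟨f, hf⟩ hef
  by_contra hne
  have hne' : e ≠ f := fun h => hne (Subtype.ext h)
  obtain ⟨⟨-, hM⟩, hdeg⟩ := hc (c ⟨e, he⟩)
  have he' : e ∈ colorClass G c (c ⟨e, he⟩) := ⟨he, rfl⟩
  have hf' : f ∈ colorClass G c (c ⟨e, he⟩) := ⟨hf, hef.symm⟩
  have hM := hM e he' f hf' hne'
  obtain ⟨i, j, rfl⟩ := hform e he
  obtain ⟨i', j', rfl⟩ := hform f hf
  have hi : i ≠ i' := by rintro rfl; exact hM _ ⟨Sym2.mem_mk_left _ _, Sym2.mem_mk_left _ _⟩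
  have hj : j ≠ j' := by rintro rfl; exact hM _ ⟨Sym2.mem_mk_right _ _, Sym2.mem_mk_right _ _⟩
  obtain ⟨v, hv, hv'⟩ := SpansForest.of_isDegenerate hdeg
    {φ.symm (.inl i), φ.symm (.inl i'), φ.symm (.inr j), φ.symm (.inr j')} (by
      rintro x (rfl | rfl | rfl | rfl)
      · exact ⟨_, he', Sym2.mem_mk_left _ _⟩
      · exact ⟨_, hf', Sym2.mem_mk_left _ _⟩
      · exact ⟨_, he', Sym2.mem_mk_right _ _⟩
      · exact ⟨_, hf', Sym2.mem_mk_right _ _⟩) ⟨_, .inl rfl⟩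
  obtain rfl | rfl | rfl | rfl := hv
  · exact hj (Sum.inr_injective (φ.symm.injective
      (hv' _ (by simp) _ (by simp) (hadj i j) (hadj i j'))))
  · exact hj (Sum.inr_injective (φ.symm.injective
      (hv' _ (by simp) _ (by simp) (hadj i' j) (hadj i' j'))))
  · exact hi (Sum.inl_injective (φ.symm.injective
      (hv' _ (by simp) _ (by simp) (hadj i j).symm (hadj i' j).symm)))
  · exact hi (Sum.inl_injective (φ.symm.injective
      (hv' _ (by simp) _ (by simp) (hadj i j').symm (hadj i' j').symm)))

lemma card_edgeSet_of_iso_completeBipartiteGraph {Δ : ℕ}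
    (φ : G ≃g completeBipartiteGraph (Fin Δ) (Fin Δ)) : Nat.card G.edgeSet = Δ ^ 2 := by
  let f : Fin Δ × Fin Δ → G.edgeSet := fun ij =>
    ⟨s(φ.symm (.inl ij.1), φ.symm (.inr ij.2)), adj_symm_of_iso φ ij.1 ij.2⟩
  have hf : Function.Bijective f := by
    constructor
    · rintro ⟨i, j⟩ ⟨i', j'⟩ h
      obtain ⟨h1, h2⟩ | ⟨h1, -⟩ := Sym2.eq_iff.1 (congrArg Subtype.val h)
      · exact Prod.ext (Sum.inl_injective (φ.symm.injective h1))
          (Sum.inr_injective (φ.symm.injective h2))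
      · exact (Sum.inl_ne_inr (φ.symm.injective h1)).elim
    · rintro ⟨e, he⟩
      obtain ⟨i, j, rfl⟩ := exists_eq_of_mem_edgeSet φ he
      exact ⟨(i, j), rfl⟩
  rw [← Nat.card_congr (Equiv.ofBijective f hf), Nat.card_prod, Nat.card_fin, sq]

end

theorem theorem2 {V : Type*} [Fintype V] (G : SimpleGraph V) [DecidableRel G.Adj]
    (hG : G.Connected) (Δ : ℕ) (hpos : 1 ≤ Δ) (hΔ : G.maxDegree ≤ Δ) :
    degenerateChromaticIndex 1 G = ((Δ ^ 2 : ℕ) : ℕ∞) ↔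
      Nonempty (G ≃g completeBipartiteGraph (Fin Δ) (Fin Δ)) := by
  constructor
  · intro hindex
    obtain ⟨c, hc⟩ := exists_isMaximumColoring G (Fin (Δ ^ 2 - 1))
    by_cases hall : ∀ e ∈ G.edgeSet, c e ≠ none
    · have hle : degenerateChromaticIndex 1 G ≤ ((Δ ^ 2 - 1 : ℕ) : ℕ∞) :=
        iInf₂_le (Δ ^ 2 - 1) (hc.toIsPartialColoring.exists_isDegenerateEdgeColoring hall)
      rw [hindex, Nat.cast_le] at hle
      have := Nat.one_le_pow 2 Δ hpos
      omega
    · push Not at hall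
      obtain ⟨e, he, h0⟩ := hall
      induction e with | _ u v
      exact hc.nonempty_iso hG hpos (fun x => (G.degree_le_maxDegree x).trans hΔ) h0 he
  · rintro ⟨φ⟩
    have hcard := card_edgeSet_of_iso_completeBipartiteGraph φ
    refine le_antisymm (iInf₂_le (Δ ^ 2) ?_) (le_iInf₂ ?_)
    · exact ⟨_, isDegenerateEdgeColoring_of_injective
        (Finite.equivFinOfCardEq hcard).injective⟩
    · rintro k ⟨c, hc⟩
      rw [Nat.cast_le, ← hcard, ← Nat.card_fin k]
      exact Nat.card_le_card_of_injective c (injective_of_isDegenerateEdgeColoring φ hc)
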